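/- For $n\ge 0$ let $S_n$ be the set of permutations of $\{1,\dots,n\}$ in one-line notation. A pass through a stack reads the entries of a permutation from left to right; before an entry $a$ is pushed, the entries on top of the stack that are smaller than $a$ are popped, one after the other, to the output (so that no entry is placed on top of a smaller one), and at the end the stack is emptied to the output. A permutation $\pi\in S_n$ is two-stack sortable if two successive passes transform it into $12\ldots n$. Let $\mathcal P(132)$ be the set of all two-stack sortable permutations, of any length $n\ge 0$ (including the empty permutation), that contain no subsequence of type $132$. For $d\ge 1$ let $12\ldots d(\pi)$ be the number of increasing subsequences of length $d$ of $\pi$. **Theorem.** Let $x_1,x_2,\ldots$ be indeterminates. Then, as formal power series in $x_1,x_2,\ldots$ with integer coefficients (both infinite sums converge coefficientwise), $$\sum_{\pi\in\mathcal P(132)}\ \prod_{d\ge1}x_d^{12\ldots d(\pi)} =1+\sum_{n\ge1}\frac{\prod_{j\ge1}x_j^{\binom nj}} {\prod_{m=1}^n\left(1-\prod_{j\ge1}x_j^{\binom{m-1}{j-1}}-\prod_{j\ge1}x_j^{2\binom{m-1}{j-1}}x_{j+1}^{\binom{m-1}{j-1}}\right)}.$$ -/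

import Mathlib

open scoped MvPowerSeries.WithPiTopology

/-- The occurrences of the pattern `τ` in `π`: the choices of `k` positions `f 0 < ⋯ < f (k-1)` of
`π` at which the entries of `π` have the same pairwise comparisons as the entries of `τ`. -/
def patternOccurrences {k n : ℕ} (τ : Equiv.Perm (Fin k)) (π : Equiv.Perm (Fin n)) :
    Set (Fin k ↪o Fin n) :=
  {f | ∀ i j : Fin k, π (f i) < π (f j) ↔ τ i < τ j}

/-- `π` avoids the pattern `τ`. -/
def AvoidsPattern {k n : ℕ} (τ : Equiv.Perm (Fin k)) (π : Equiv.Perm (Fin n)) : Prop :=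
  patternOccurrences τ π = ∅

/-- The number of subsequences of type `12…d` in `π`. -/
noncomputable def incCount (d : ℕ) {n : ℕ} (π : Equiv.Perm (Fin n)) : ℕ :=
  (patternOccurrences (1 : Equiv.Perm (Fin d)) π).ncard

/-- The pattern `132` (in one-line notation on `{0, 1, 2}`: `0, 2, 1`). -/
def perm132 : Equiv.Perm (Fin 3) := Equiv.swap 1 2

/-- One-line notation of a permutation. -/
def oneLine {n : ℕ} (π : Equiv.Perm (Fin n)) : List (Fin n) := List.ofFn π

/-- One pass through a stack. The first argument is the current stack (top first), the second one
the remaining input, the result is the output. Before the next input entry `a` is pushed, the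
entries on top of the stack that are smaller than `a` are popped to the output, so that no entry is
ever placed on top of a smaller one; when the input is exhausted, the stack is emptied. -/
def stackPass {α : Type*} [LinearOrder α] : List α → List α → List α
  | st, [] => st
  | st, a :: l =>
      st.takeWhile (fun b => decide (b < a)) ++
        stackPass (a :: st.dropWhile (fun b => decide (b < a))) l

/-- The stack-sorting map: a pass through an initially empty stack. -/
def stackSort {α : Type*} [LinearOrder α] (l : List α) : List α := stackPass [] l

/-- `π` is two-stack sortable: two passes through a stack turn `π` into `1 2 … n`. -/
def IsTwoStackSortable {n : ℕ} (π : Equiv.Perm (Fin n)) : Prop :=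
  stackSort (stackSort (oneLine π)) = oneLine (1 : Equiv.Perm (Fin n))

/-- The set `P(132)` of all two-stack sortable permutations, of any length `n ≥ 0`, that
avoid `132`. -/
def P132 : Set (Σ n : ℕ, Equiv.Perm (Fin n)) :=
  {π | IsTwoStackSortable π.2 ∧ AvoidsPattern perm132 π.2}

/-- The factor
`1 - ∏_{j ≥ 1} x_j ^ C(m-1, j-1) - ∏_{j ≥ 1} x_j ^ (2 C(m-1, j-1)) x_{j+1} ^ C(m-1, j-1)`. -/
noncomputable def denomFactor (m : ℕ) : MvPowerSeries ℕ+ ℤ :=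
  1 - ∏ᶠ j : ℕ+, MvPowerSeries.X j ^ (m - 1).choose ((j : ℕ) - 1)
    - ∏ᶠ j : ℕ+, MvPowerSeries.X j ^ (2 * (m - 1).choose ((j : ℕ) - 1))
        * MvPowerSeries.X (j + 1) ^ (m - 1).choose ((j : ℕ) - 1)

theorem finite_choose_ne_zero (m : ℕ) :
    {j : ℕ+ | (m - 1).choose ((j : ℕ) - 1) ≠ 0}.Finite := by
  refine Set.Finite.subset (Set.finite_Iic (⟨m + 1, Nat.succ_pos m⟩ : ℕ+)) ?_
  intro j hj
  have h : (j : ℕ) - 1 ≤ m - 1 := by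
    by_contra hlt
    exact hj (Nat.choose_eq_zero_of_lt (not_le.mp hlt))
  change (j : ℕ) ≤ m + 1
  omega

theorem constantCoeff_denomFactor (m : ℕ) :
    MvPowerSeries.constantCoeff (denomFactor m) = 1 := by
  have key : ∀ g : ℕ+ → MvPowerSeries ℕ+ ℤ,
      (∀ j : ℕ+, (m - 1).choose ((j : ℕ) - 1) = 0 → g j = 1) →
      MvPowerSeries.constantCoeff (g 1) = 0 →
      MvPowerSeries.constantCoeff (∏ᶠ j, g j) = 0 := by
    intro g hg h1
    have hfin : (Function.mulSupport g).Finite := by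
      refine (finite_choose_ne_zero m).subset ?_
      intro j hj h0
      exact hj (hg j h0)
    rw [finprod_eq_prod _ hfin, map_prod]
    refine Finset.prod_eq_zero (i := 1) ?_ h1
    rw [Set.Finite.mem_toFinset]
    intro h
    rw [h] at h1
    simp at h1
  unfold denomFactor
  rw [map_sub, map_sub, key, key]
  · simp
  · intro j hj
    simp [hj]
  · simp
  · intro j hj
    simp [hj]
  · simp

/-- The denominator `∏_{m=1}^n denomFactor m` of the `n`-th summand. -/
noncomputable def denom (n : ℕ) : MvPowerSeries ℕ+ ℤ :=
  ∏ m ∈ Finset.Icc 1 n, denomFactor m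

/-- The reciprocal `1 / denom n` in the ring of formal power series (`invOfUnit _ 1` is the
inverse of a series with constant coefficient `1`). -/
noncomputable def denomInv (n : ℕ) : MvPowerSeries ℕ+ ℤ :=
  MvPowerSeries.invOfUnit (denom n) 1

theorem denom_mul_denomInv (n : ℕ) : denom n * denomInv n = 1 := by
  refine MvPowerSeries.mul_invOfUnit _ _ ?_
  simp [denom, map_prod, constantCoeff_denomFactor]

/-!
Let `n` be the largest entry of a `132`-avoiding two-stack sortable permutation. Every entry to the
left of `n` exceeds every entry to its right, and if both sides are nonempty, then two-stack
sortability forces the left side to be the single entry `n - 1`. Hence every nonempty such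
permutation is in exactly one way of the form `σ n` (with `σ` possibly empty), `n σ` or
`(n - 1) n σ` (with `σ` nonempty). An increasing subsequence of `σ n` may or may not end in `n`, so
the monomial of `σ n` is `x_1` times that of `σ` after the substitution `x_d ↦ x_d x_{d+1}`; the
monomials of `n σ` and `(n - 1) n σ` are `x_1` and `x_1² x_2` times that of `σ`. If `F_k` is the
generating function of the nonempty permutations after `k` such substitutions and
`m_k = ∏ x_j ^ C(k, j - 1)` is the image of `x_1`, this reads
`F_k = m_k (1 + F_{k+1}) + m_k F_k + m_k m_{k+1} F_k`, that is
`denomFactor (k + 1) * F_k = m_k * (1 + F_{k+1})`. Iterating from `F_0` gives the series: the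
remainder after `n` steps is divisible by `x_1 ^ n`.
-/

open scoped List

theorem sortedLT_concat_iff {α : Type*} [Preorder α] {l : List α} {m : α} (hl : ∀ x ∈ l, x < m) :
    (l ++ [m]).SortedLT ↔ l.SortedLT := by
  simpa [List.sortedLT_iff_pairwise, List.pairwise_append] using fun _ => hl

section StackSort

variable {α β : Type*} [LinearOrder α] [LinearOrder β]

theorem stackPass_perm (st l : List α) : stackPass st l ~ st ++ l := by
  induction l generalizing st with
  | nil => simp [stackPass]
  | cons a l ih =>
    rw [stackPass]
    set small := st.takeWhile fun b => decide (b < a)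
    set large := st.dropWhile fun b => decide (b < a)
    calc small ++ stackPass (a :: large) l
      _ ~ small ++ a :: (large ++ l) := (ih _).append_left _
      _ ~ a :: (small ++ (large ++ l)) := List.perm_middle
      _ = a :: (st ++ l) := by rw [← List.append_assoc, List.takeWhile_append_dropWhile]
      _ ~ st ++ a :: l := List.perm_middle.symm

theorem stackSort_perm (l : List α) : stackSort l ~ l := stackPass_perm [] l

theorem mem_stackSort {l : List α} {x : α} : x ∈ stackSort l ↔ x ∈ l :=
  (stackSort_perm l).mem_iff

theorem stackSort_eq_nil_iff {l : List α} : stackSort l = [] ↔ l = [] := by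
  simpa using (stackSort_perm l).congr_left []

theorem stackSort_nil : stackSort ([] : List α) = [] := rfl

theorem stackSort_singleton (a : α) : stackSort [a] = [a] := rfl

theorem stackPass_append_cons {m : α} {st L : List α} (R : List α) (hst : ∀ x ∈ st, x < m)
    (hL : ∀ x ∈ L, x < m) : stackPass st (L ++ m :: R) = stackPass st L ++ stackPass [m] R := by
  induction L generalizing st with
  | nil =>
    have hpop : ∀ x ∈ st, decide (x < m) = true := by simpa using hst
    simp [stackPass, List.takeWhile_eq_self_iff.2 hpop, List.dropWhile_eq_nil_iff.2 hpop]
  | cons a L ih =>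
    rw [List.forall_mem_cons] at hL
    rw [List.cons_append, stackPass, stackPass, ih _ hL.2, List.append_assoc]
    exact List.forall_mem_cons.2
      ⟨hL.1, fun x hx => hst x ((List.dropWhile_suffix _).mem hx)⟩

theorem stackPass_concat {m : α} {R : List α} (st : List α) (hR : ∀ x ∈ R, x < m) :
    stackPass (st ++ [m]) R = stackPass st R ++ [m] := by
  induction R generalizing st with
  | nil => simp [stackPass]
  | cons a R ih =>
    rw [List.forall_mem_cons] at hR
    have htake : (st ++ [m]).takeWhile (fun b => decide (b < a))
        = st.takeWhile fun b => decide (b < a) := by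
      rw [List.takeWhile_append]
      split_ifs with hlen
      · simp [(List.takeWhile_prefix _).eq_of_length hlen, hR.1.not_gt]
      · rfl
    have hdrop : (st ++ [m]).dropWhile (fun b => decide (b < a))
        = st.dropWhile (fun b => decide (b < a)) ++ [m] := by
      refine List.append_cancel_left (as := st.takeWhile fun b => decide (b < a)) ?_
      rw [← List.append_assoc, List.takeWhile_append_dropWhile, ← htake,
        List.takeWhile_append_dropWhile]
    rw [stackPass, stackPass, htake, hdrop, ← List.cons_append, ih _ hR.2, List.append_assoc]

theorem stackSort_append_cons {m : α} {L R : List α} (hL : ∀ x ∈ L, x < m)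
    (hR : ∀ x ∈ R, x < m) :
    stackSort (L ++ m :: R) = stackSort L ++ stackSort R ++ [m] := by
  rw [stackSort, stackPass_append_cons R (by simp) hL, ← List.nil_append [m],
    stackPass_concat [] hR, List.append_assoc]
  rfl

theorem stackPass_map {f : α → β} (hf : StrictMono f) (st l : List α) :
    stackPass (st.map f) (l.map f) = (stackPass st l).map f := by
  induction l generalizing st with
  | nil => simp [stackPass]
  | cons a l ih =>
    simp only [List.map_cons, stackPass, List.takeWhile_map, List.dropWhile_map, List.map_append,
      ← ih, Function.comp_def, hf.lt_iff_lt]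

theorem stackSort_map {f : α → β} (hf : StrictMono f) (l : List α) :
    stackSort (l.map f) = (stackSort l).map f := stackPass_map hf [] l

theorem stackSort_stackSort_append_cons {m : α} {L R : List α} (hL : ∀ x ∈ L, x < m)
    (hR : ∀ x ∈ R, x < m) :
    stackSort (stackSort (L ++ m :: R)) = stackSort (stackSort L ++ stackSort R) ++ [m] := by
  have hLR : ∀ x ∈ stackSort L ++ stackSort R, x < m := by
    simpa only [List.forall_mem_append, mem_stackSort] using And.intro hL hR
  rw [stackSort_append_cons hL hR, stackSort_append_cons hLR (by simp)]
  simp [stackSort, stackPass]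

/-- The analogue of `IsTwoStackSortable` for words over any linear order. -/
def SortedByTwoPasses (l : List α) : Prop := (stackSort (stackSort l)).SortedLT

theorem sortedByTwoPasses_append_cons_iff {m : α} {L R : List α} (hL : ∀ x ∈ L, x < m)
    (hR : ∀ x ∈ R, x < m) :
    SortedByTwoPasses (L ++ m :: R) ↔ (stackSort (stackSort L ++ stackSort R)).SortedLT := by
  rw [SortedByTwoPasses, stackSort_stackSort_append_cons hL hR, sortedLT_concat_iff]
  simpa only [mem_stackSort, List.forall_mem_append] using And.intro hL hR

theorem sortedByTwoPasses_map_iff {f : α → β} (hf : StrictMono f) {l : List α} :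
    SortedByTwoPasses (l.map f) ↔ SortedByTwoPasses l := by
  simp only [SortedByTwoPasses, stackSort_map hf, List.sortedLT_iff_pairwise, List.pairwise_map,
    hf.lt_iff_lt]

theorem exists_eq_append_cons_of_nodup {l : List α} (hne : l ≠ []) (hl : l.Nodup) :
    ∃ L m R, l = L ++ m :: R ∧ (∀ x ∈ L, x < m) ∧ ∀ x ∈ R, x < m := by
  obtain ⟨m, hm, hmax⟩ :=
    Set.exists_max_image _ id l.finite_toSet (List.exists_mem_of_ne_nil l hne)
  obtain ⟨L, R, rfl⟩ := List.append_of_mem hm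
  have hnot : m ∉ L ++ R := (List.nodup_cons.1 (List.nodup_middle.1 hl)).1
  have hlt : ∀ x ∈ L ++ R, x < m := fun x hx =>
    (hmax x (List.perm_middle.mem_iff.2 (List.mem_cons_of_mem m hx))).lt_of_ne
      fun (h : x = m) => hnot (h ▸ hx)
  exact ⟨L, m, R, rfl, List.forall_mem_append.1 hlt⟩

/-- After the first pass a second entry of `L` would stand before the largest entry of `L`, which
in turn precedes the smaller entries of `R`: a pattern `231`, which one more pass cannot sort. -/
theorem eq_singleton_of_sortedLT_stackSort_append {L R : List α} (hLne : L ≠ []) (hRne : R ≠ [])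
    (hRL : ∀ a ∈ L, ∀ c ∈ R, c ≤ a)
    (hsorted : (stackSort (stackSort L ++ stackSort R)).SortedLT) : ∃ M, L = [M] := by
  have hnodup : (L ++ R).Nodup :=
    ((stackSort_perm _).trans ((stackSort_perm L).append (stackSort_perm R))).nodup_iff.1
      hsorted.nodup
  obtain ⟨L₁, M, L₂, rfl, hL₁, hL₂⟩ := exists_eq_append_cons_of_nodup hLne hnodup.of_append_left
  set X := stackSort L₁ ++ stackSort L₂ with hX
  have hXM : ∀ x ∈ X, x < M := by
    simpa only [hX, List.forall_mem_append, mem_stackSort] using And.intro hL₁ hL₂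
  have hRM : ∀ c ∈ stackSort R, c < M := fun c hc =>
    have hc := mem_stackSort.1 hc
    (hRL M (by simp) c hc).lt_of_ne
      ((List.nodup_append.1 hnodup).2.2 M (by simp) c hc).symm
  rw [stackSort_append_cons hL₁ hL₂, List.append_assoc, List.singleton_append,
    stackSort_append_cons hXM hRM, List.sortedLT_iff_pairwise, List.pairwise_append,
    List.pairwise_append] at hsorted
  obtain ⟨c, hc⟩ := List.exists_mem_of_ne_nil R hRne
  have hXnil : X = [] := List.eq_nil_iff_forall_not_mem.2 fun x hx => by
    have hxc : x < c := hsorted.1.2.2 x (mem_stackSort.2 hx) c (by simpa only [mem_stackSort])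
    have hxL : x ∈ L₁ ++ M :: L₂ := by
      simp only [hX, List.mem_append, mem_stackSort] at hx
      simp only [List.mem_append, List.mem_cons]
      tauto
    exact (hRL x hxL c hc).not_gt hxc
  simp only [hX, List.append_eq_nil_iff, stackSort_eq_nil_iff] at hXnil
  exact ⟨M, by simp [hXnil]⟩

end StackSort

section Avoids132

variable {α : Type*}

/-- The analogue of `AvoidsPattern perm132` for words over any alphabet with an order relation. -/
def ListAvoids132 [LT α] (l : List α) : Prop := ∀ a b c : α, a < c → c < b → ¬ [a, b, c] <+ l

theorem ListAvoids132.sublist [LT α] {l l' : List α} (h : ListAvoids132 l) (hs : l' <+ l) :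
    ListAvoids132 l' := fun a b c hac hcb ht => h a b c hac hcb (ht.trans hs)

theorem listAvoids132_of_length_le_one [LT α] {l : List α} (hl : l.length ≤ 1) :
    ListAvoids132 l := fun _ _ _ _ _ h => by
  simpa using h.length_le.trans hl

theorem listAvoids132_append_cons_iff [LinearOrder α] {m : α} {L R : List α} (hL : ∀ x ∈ L, x < m)
    (hR : ∀ x ∈ R, x < m) :
    ListAvoids132 (L ++ m :: R) ↔
      ListAvoids132 L ∧ ListAvoids132 R ∧ ∀ a ∈ L, ∀ c ∈ R, c ≤ a := by
  constructor
  · refine fun h => ⟨h.sublist (List.sublist_append_left _ _), h.sublist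
      ((List.sublist_cons_self _ _).trans (List.sublist_append_right _ _)), fun a ha c hc => ?_⟩
    by_contra! hac
    exact h a m c hac (hR c hc)
      ((List.singleton_sublist.2 ha).append ((List.singleton_sublist.2 hc).cons_cons m))
  · rintro ⟨hLav, hRav, hRL⟩ a b c hac hcb hs
    obtain ⟨t₁, t₂, ht, h₁, h₂⟩ := List.sublist_append_iff.1 hs
    rcases t₁ with _ | ⟨a', _ | ⟨b', _ | ⟨c', t₁⟩⟩⟩ <;>
      simp only [List.nil_append, List.cons_append, List.cons.injEq] at ht
    · subst ht
      rcases List.cons_sublist_cons'.1 h₂ with h | ⟨rfl, h⟩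
      · exact hRav a b c hac hcb h
      · exact hac.not_gt (hR c (h.subset (by simp)))
    · obtain ⟨rfl, rfl⟩ := ht
      have hc : c ∈ R := h₂.tail.subset (by simp)
      exact (hRL a (h₁.subset (by simp)) c hc).not_gt hac
    · obtain ⟨rfl, rfl, rfl⟩ := ht
      have hbm : b < m := hL b (h₁.subset (by simp))
      have hc : c ∈ R :=
        (List.mem_cons.1 (h₂.subset (by simp))).resolve_left (hcb.trans hbm).ne
      exact (hRL a (h₁.subset (by simp)) c hc).not_gt hac
    · obtain ⟨rfl, rfl, rfl, ht⟩ := ht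
      obtain ⟨rfl, -⟩ := List.append_eq_nil_iff.1 ht.symm
      exact hLav a b c hac hcb h₁

end Avoids132

section PascalShift

/-- The action of the substitution `x_d ↦ x_d x_{d+1}` on exponents of monomials. -/
noncomputable def pascalShift : AddMonoid.End (ℕ+ →₀ ℕ) :=
  AddMonoidHom.id _ + Finsupp.mapDomain.addMonoidHom (· + 1)

theorem pascalShift_eq_add_mapDomain (e : ℕ+ →₀ ℕ) :
    pascalShift e = e + e.mapDomain (· + 1) := rfl

theorem pascalShift_apply_one (e : ℕ+ →₀ ℕ) : pascalShift e 1 = e 1 := by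
  have hone : (1 : ℕ+) ∉ Set.range (· + 1) := by
    rintro ⟨d, hd⟩
    exact (PNat.lt_add_left 1 d).ne' hd
  rw [pascalShift_eq_add_mapDomain, Finsupp.add_apply, Finsupp.mapDomain_of_notMem_range _ _ hone,
    add_zero]

theorem pascalShift_apply_add_one (e : ℕ+ →₀ ℕ) (d : ℕ+) :
    pascalShift e (d + 1) = e (d + 1) + e d := by
  rw [pascalShift_eq_add_mapDomain, Finsupp.add_apply,
    Finsupp.mapDomain_apply (add_left_injective 1)]

theorem pascalShift_pow_apply_one (k : ℕ) (e : ℕ+ →₀ ℕ) : (pascalShift ^ k) e 1 = e 1 := by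
  induction k with
  | zero => rfl
  | succ k ih =>
    rw [pow_succ', AddMonoid.End.coe_mul, Function.comp_apply, pascalShift_apply_one, ih]

/-- The exponent of the monomial `∏ x_j ^ C(k, j - 1)`, i.e. of `x_1` after `k` substitutions
`x_d ↦ x_d x_{d+1}`. -/
noncomputable def predChooseExponent (k : ℕ) : ℕ+ →₀ ℕ := (pascalShift ^ k) (Finsupp.single 1 1)

theorem predChooseExponent_succ (k : ℕ) :
    predChooseExponent (k + 1) = pascalShift (predChooseExponent k) := by
  rw [predChooseExponent, pow_succ', AddMonoid.End.coe_mul, Function.comp_apply, predChooseExponent]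

theorem predChooseExponent_apply (k : ℕ) (j : ℕ+) :
    predChooseExponent k j = k.choose ((j : ℕ) - 1) := by
  induction k generalizing j with
  | zero =>
    rcases eq_or_ne j 1 with rfl | hj
    · simp [predChooseExponent]
    · have hpos : 0 < (j : ℕ) - 1 :=
        Nat.sub_pos_of_lt ((PNat.coe_lt_coe 1 j).2 (one_le.lt_of_ne' hj))
      simp [predChooseExponent, hj, Nat.choose_eq_zero_of_lt hpos]
  | succ k ih =>
    rw [predChooseExponent_succ]
    induction j using PNat.recOn with
    | one => simp [pascalShift_apply_one, ih]
    | succ j _ =>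
      rw [pascalShift_apply_add_one, ih, ih, PNat.add_coe, PNat.val_ofNat, Nat.add_sub_cancel,
        Nat.choose_eq_choose_pred_add k.succ_pos j.pos, Nat.succ_sub_one, add_comm]

/-- The exponent of the monomial `∏ x_j ^ C(n, j)`. -/
noncomputable def chooseExponent (n : ℕ) : ℕ+ →₀ ℕ := ∑ m ∈ Finset.range n, predChooseExponent m

theorem chooseExponent_succ (n : ℕ) :
    chooseExponent (n + 1) = chooseExponent n + predChooseExponent n :=
  Finset.sum_range_succ _ _

theorem chooseExponent_apply (n : ℕ) (j : ℕ+) : chooseExponent n j = n.choose j := by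
  induction n with
  | zero => simp [chooseExponent, Nat.choose_eq_zero_of_lt j.pos]
  | succ n ih =>
    rw [chooseExponent_succ, Finsupp.add_apply, ih, predChooseExponent_apply,
      Nat.choose_eq_choose_pred_add n.succ_pos j.pos, Nat.succ_sub_one, add_comm]

end PascalShift

section IncreasingSublists

variable {α : Type*} [Preorder α]

/-- The increasing subsequences of length `d` of a word. -/
def incSublists (d : ℕ) (l : List α) : Set (List α) :=
  {t | t <+ l ∧ t.length = d ∧ t.SortedLT}

theorem finite_incSublists (d : ℕ) (l : List α) : (incSublists d l).Finite :=
  l.sublists.finite_toSet.subset fun _ ht => List.mem_sublists.2 ht.1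

theorem incSublists_zero (l : List α) : incSublists 0 l = {[]} := by
  ext t
  simp +contextual [incSublists, iff_def, List.length_eq_zero_iff, List.sortedLT_iff_pairwise]

theorem incSublists_mono {l l' : List α} (d : ℕ) (h : l <+ l') :
    incSublists d l ⊆ incSublists d l' := fun _ ht => ⟨ht.1.trans h, ht.2⟩

theorem incSublists_eq_empty {d : ℕ} {l : List α} (h : l.length < d) : incSublists d l = ∅ :=
  Set.eq_empty_of_forall_notMem fun _ ht => h.not_ge (ht.2.1 ▸ ht.1.length_le)

theorem incSublists_concat {l : List α} {n : α} (d : ℕ) (h : ∀ x ∈ l, x < n) :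
    incSublists (d + 1) (l ++ [n]) = incSublists (d + 1) l ∪ (· ++ [n]) '' incSublists d l := by
  ext t
  constructor
  · rintro ⟨hs, hlen, ht⟩
    obtain ⟨t₁, t₂, rfl, h₁, h₂⟩ := List.sublist_append_iff.1 hs
    rcases List.sublist_singleton.1 h₂ with rfl | rfl
    · rw [List.append_nil] at *
      exact Or.inl ⟨h₁, hlen, ht⟩
    · have hlt : ∀ x ∈ t₁, x < n := fun x hx => h x (h₁.subset hx)
      exact Or.inr ⟨t₁, ⟨h₁, by simpa using hlen, (sortedLT_concat_iff hlt).1 ht⟩, rfl⟩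
  · rintro (ht | ⟨t, ⟨hs, hlen, ht⟩, rfl⟩)
    · exact incSublists_mono _ (List.sublist_append_left _ _) ht
    · exact ⟨hs.append_right _, by simpa using hlen,
        (sortedLT_concat_iff fun x hx => h x (hs.subset hx)).2 ht⟩

theorem ncard_incSublists_concat {l : List α} {n : α} (d : ℕ) (h : ∀ x ∈ l, x < n) :
    (incSublists (d + 1) (l ++ [n])).ncard
      = (incSublists (d + 1) l).ncard + (incSublists d l).ncard := by
  have hdisj : Disjoint (incSublists (d + 1) l) ((· ++ [n]) '' incSublists d l) := by
    rw [Set.disjoint_left]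
    rintro _ ⟨hs, -⟩ ⟨t, -, rfl⟩
    exact (h n (hs.subset (by simp))).ne rfl
  rw [incSublists_concat d h, Set.ncard_union_eq hdisj (finite_incSublists _ _)
    ((finite_incSublists _ _).image _),
    Set.ncard_image_of_injective _ (List.append_left_injective _)]

theorem incSublists_append {L R : List α} (d : ℕ) (h : ∀ a ∈ L, ∀ c ∈ R, c < a) :
    incSublists d (L ++ R) = incSublists d L ∪ incSublists d R := by
  ext t
  constructor
  · rintro ⟨hs, hlen, ht⟩
    obtain ⟨t₁, t₂, rfl, h₁, h₂⟩ := List.sublist_append_iff.1 hs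
    rcases t₁ with _ | ⟨a, t₁⟩
    · exact Or.inr ⟨h₂, hlen, ht⟩
    rcases t₂ with _ | ⟨c, t₂⟩
    · rw [List.append_nil] at *
      exact Or.inl ⟨h₁, hlen, ht⟩
    have hac : a < c := (List.pairwise_append.1 ht.pairwise).2.2 a (by simp) c (by simp)
    exact absurd (h a (h₁.subset (by simp)) c (h₂.subset (by simp))) hac.not_gt
  · rintro (ht | ht)
    · exact incSublists_mono _ (List.sublist_append_left _ _) ht
    · exact incSublists_mono _ (List.sublist_append_right _ _) ht

theorem ncard_incSublists_append {L R : List α} (d : ℕ+) (h : ∀ a ∈ L, ∀ c ∈ R, c < a) :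
    (incSublists d (L ++ R)).ncard = (incSublists d L).ncard + (incSublists d R).ncard := by
  have hdisj : Disjoint (incSublists d L) (incSublists (d : ℕ) R) := by
    rw [Set.disjoint_left]
    rintro t ⟨hL, hlen, -⟩ ⟨hR, -⟩
    obtain ⟨x, hx⟩ := List.exists_mem_of_length_pos (hlen ▸ d.pos)
    exact (h x (hL.subset hx) x (hR.subset hx)).false
  rw [incSublists_append _ h, Set.ncard_union_eq hdisj (finite_incSublists _ _)
    (finite_incSublists _ _)]

theorem incSublists_one (l : List α) : incSublists 1 l = (fun x => [x]) '' {x | x ∈ l} := by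
  ext t
  constructor
  · rintro ⟨hs, hlen, -⟩
    obtain ⟨x, rfl⟩ := List.length_eq_one_iff.1 hlen
    exact ⟨x, List.singleton_sublist.1 hs, rfl⟩
  · rintro ⟨x, hx, rfl⟩
    exact ⟨List.singleton_sublist.2 hx, rfl, by simp [List.sortedLT_iff_pairwise]⟩

/-- The exponent of the monomial `∏ x_d ^ (12…d)(l)` of a word `l`. -/
noncomputable def incExponent (l : List α) : ℕ+ →₀ ℕ :=
  Finsupp.ofSupportFinite (fun d => (incSublists d l).ncard) <| by
    refine (Set.finite_Iic (l.length.succPNat)).subset fun d hd => ?_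
    by_contra! hlt
    refine hd ?_
    have hlen : l.length < d := (Nat.lt_succ_self _).trans (not_le.1 hlt)
    simp [incSublists_eq_empty hlen]

theorem incExponent_apply (l : List α) (d : ℕ+) :
    incExponent l d = (incSublists d l).ncard := rfl

theorem incExponent_apply_one {l : List α} (hl : l.Nodup) : incExponent l 1 = l.length := by
  classical
  rw [incExponent_apply, PNat.one_coe, incSublists_one,
    Set.ncard_image_of_injective _ List.singleton_injective, ← List.toFinset_card_of_nodup hl,
    ← Set.ncard_coe_finset, List.coe_toFinset]

theorem incExponent_nil : incExponent ([] : List α) = 0 := by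
  ext d
  simp [incExponent_apply, incSublists_eq_empty]

theorem incExponent_append {L R : List α} (h : ∀ a ∈ L, ∀ c ∈ R, c < a) :
    incExponent (L ++ R) = incExponent L + incExponent R := by
  ext d
  exact ncard_incSublists_append d h

theorem incExponent_concat {l : List α} {n : α} (h : ∀ x ∈ l, x < n) :
    incExponent (l ++ [n]) = Finsupp.single 1 1 + pascalShift (incExponent l) := by
  ext d
  induction d using PNat.recOn with
  | one =>
    have hcount := ncard_incSublists_concat 0 h
    rw [incSublists_zero, Set.ncard_singleton] at hcount
    rw [Finsupp.add_apply, Finsupp.single_eq_same, pascalShift_apply_one, add_comm]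
    exact hcount
  | succ d _ =>
    have hd : (1 : ℕ+) ≠ d + 1 := (PNat.lt_add_left 1 d).ne
    rw [Finsupp.add_apply, Finsupp.single_eq_of_ne' hd, pascalShift_apply_add_one, zero_add]
    exact ncard_incSublists_concat d h

theorem incExponent_singleton (n : α) : incExponent [n] = Finsupp.single 1 1 := by
  simpa [incExponent_nil] using incExponent_concat (l := []) (n := n) (by simp)

end IncreasingSublists

section PowerSeries

variable {σ τ R : Type*}

theorem hasFiniteMulSupport_pow {M : Type*} [Monoid M] (f : σ → M) (e : σ →₀ ℕ) :
    Function.HasFiniteMulSupport fun i => f i ^ e i :=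
  e.hasFiniteSupport.subset fun i hi h => hi (by simp only [h, pow_zero])

theorem finprod_X_comp_pow [CommSemiring R] (g : σ → τ) (e : σ →₀ ℕ) :
    (∏ᶠ i, MvPowerSeries.X (g i) ^ e i : MvPowerSeries τ R)
      = MvPowerSeries.monomial (e.mapDomain g) 1 := by
  rw [MvPowerSeries.monomial_eq', map_one, one_mul,
    Finsupp.prod_mapDomain_index (fun _ => pow_zero _) (fun _ _ _ => pow_add _ _ _), Finsupp.prod]
  exact finprod_eq_prod_of_mulSupport_subset _ fun i hi =>
    Finsupp.mem_support_iff.2 fun h => hi (by simp only [h, pow_zero])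

theorem finprod_X_pow [CommSemiring R] (e : σ →₀ ℕ) :
    (∏ᶠ i, MvPowerSeries.X i ^ e i : MvPowerSeries σ R) = MvPowerSeries.monomial e 1 := by
  simpa using finprod_X_comp_pow (R := R) id e

theorem summable_monomial {ι : Type*} [Semiring R] [TopologicalSpace R] {e : ι → σ →₀ ℕ}
    (he : ∀ a, {i | e i = a}.Finite) :
    Summable fun i => (MvPowerSeries.monomial (e i) 1 : MvPowerSeries σ R) := by
  refine MvPowerSeries.WithPiTopology.summable_iff_summable_coeff.2 fun a =>
    summable_of_hasFiniteSupport ((he a).subset fun i hi => ?_)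
  exact (MvPowerSeries.eq_of_coeff_monomial_ne_zero hi).symm

end PowerSeries

section Denominators

theorem denomFactor_succ (k : ℕ) :
    denomFactor (k + 1) = 1 - MvPowerSeries.monomial (predChooseExponent k) 1
      - MvPowerSeries.monomial (predChooseExponent k + predChooseExponent (k + 1)) 1 := by
  set e := predChooseExponent k with he
  have hchoose (j : ℕ+) : (k + 1 - 1).choose ((j : ℕ) - 1) = e j :=
    (predChooseExponent_apply k j).symm
  have hdouble (j : ℕ+) : 2 * e j = (2 • e) j := rfl
  have hsplit := finprod_mul_distrib
    (hasFiniteMulSupport_pow (MvPowerSeries.X : ℕ+ → MvPowerSeries ℕ+ ℤ) (2 • e))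
    (hasFiniteMulSupport_pow (fun j => MvPowerSeries.X (j + 1)) e)
  rw [denomFactor]
  simp only [hchoose, hdouble]
  rw [hsplit, finprod_X_pow, finprod_X_pow, finprod_X_comp_pow, MvPowerSeries.monomial_mul_monomial,
    one_mul, predChooseExponent_succ, ← he, pascalShift_eq_add_mapDomain, two_nsmul, add_assoc]

theorem denomInv_zero : denomInv 0 = 1 := by
  simpa [denom] using denom_mul_denomInv 0

theorem denomInv_eq_denomInv_succ_mul (n : ℕ) :
    denomInv n = denomInv (n + 1) * denomFactor (n + 1) := by
  have hsucc : denom (n + 1) = denom n * denomFactor (n + 1) := Finset.prod_Icc_succ_top (by simp) _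
  calc denomInv n
    _ = denomInv n * (denom n * denomFactor (n + 1) * denomInv (n + 1)) := by
      rw [← hsucc, denom_mul_denomInv, mul_one]
    _ = denom n * denomInv n * (denomInv (n + 1) * denomFactor (n + 1)) := by ring
    _ = denomInv (n + 1) * denomFactor (n + 1) := by rw [denom_mul_denomInv, one_mul]

end Denominators

section Words

theorem append_cons_perm_range_iff {L R : List ℕ} {n : ℕ} :
    L ++ n :: R ~ List.range (n + 1) ↔ L ++ R ~ List.range n := by
  have hrange : List.range (n + 1) ~ n :: List.range n := by
    simpa only [List.range_succ] using List.perm_append_singleton _ _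
  rw [← List.perm_cons n (l₁ := L ++ R)]
  exact (List.perm_middle.congr_left _).trans (hrange.congr_right _)

/-- The one-line notations, with entries `0, …, n - 1`, of the permutations in `P132`. -/
def p132Words : Set (List ℕ) :=
  {l | l ~ List.range l.length ∧ ListAvoids132 l ∧ SortedByTwoPasses l}

theorem append_cons_mem_p132Words_iff {L R : List ℕ} {n : ℕ} (hn : L.length + R.length = n) :
    L ++ n :: R ∈ p132Words ↔ L ++ R ~ List.range n ∧
      (ListAvoids132 L ∧ ListAvoids132 R ∧ ∀ a ∈ L, ∀ c ∈ R, c ≤ a) ∧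
      (stackSort (stackSort L ++ stackSort R)).SortedLT := by
  have hlen : (L ++ n :: R).length = n + 1 := by simp [← hn, add_assoc]
  simp only [p132Words, Set.mem_ofPred_eq, hlen, append_cons_perm_range_iff]
  refine and_congr_right fun hperm => ?_
  have hlt : ∀ x ∈ L ++ R, x < n := fun x hx => List.mem_range.1 (hperm.subset hx)
  rw [List.forall_mem_append] at hlt
  rw [listAvoids132_append_cons_iff hlt.1 hlt.2, sortedByTwoPasses_append_cons_iff hlt.1 hlt.2]

theorem lt_length_of_mem_p132Words {l : List ℕ} (hl : l ∈ p132Words) {x : ℕ} (hx : x ∈ l) :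
    x < l.length := List.mem_range.1 (hl.1.subset hx)

/-- The operation `σ ↦ σ n` on words, `n` being the new largest entry. -/
def appendMax (l : List ℕ) : List ℕ := l ++ [l.length]

/-- The operation `σ ↦ n σ` on words, `n` being the new largest entry. -/
def consMax (l : List ℕ) : List ℕ := l.length :: l

/-- The operation `σ ↦ (n - 1) n σ` on words, `n - 1` and `n` being the new largest entries. -/
def consMaxPair (l : List ℕ) : List ℕ := l.length :: (l.length + 1) :: l

theorem appendMax_injective : Function.Injective appendMax := fun _ _ h =>
  (List.append_inj' h rfl).1

theorem consMax_injective : Function.Injective consMax := fun _ _ h => List.tail_eq_of_cons_eq h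

theorem consMaxPair_injective : Function.Injective consMaxPair := fun _ _ h =>
  List.tail_eq_of_cons_eq (List.tail_eq_of_cons_eq h)

theorem nil_mem_p132Words : [] ∈ p132Words :=
  ⟨.refl _, listAvoids132_of_length_le_one (by simp), List.Pairwise.nil.sortedLT⟩

theorem appendMax_mem_p132Words_iff {l : List ℕ} : appendMax l ∈ p132Words ↔ l ∈ p132Words := by
  rw [appendMax, append_cons_mem_p132Words_iff (by simp)]
  simp [p132Words, listAvoids132_of_length_le_one, SortedByTwoPasses, stackSort_nil]

theorem consMax_mem_p132Words_iff {l : List ℕ} : consMax l ∈ p132Words ↔ l ∈ p132Words := by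
  rw [consMax, ← List.nil_append (_ :: l), append_cons_mem_p132Words_iff (by simp)]
  simp [p132Words, listAvoids132_of_length_le_one, SortedByTwoPasses, stackSort_nil]

theorem consMaxPair_mem_p132Words_iff {l : List ℕ} :
    consMaxPair l ∈ p132Words ↔ l ∈ p132Words := by
  rw [consMaxPair, ← List.singleton_append, append_cons_mem_p132Words_iff (by simp [add_comm]),
    List.singleton_append, ← List.nil_append (_ :: l), append_cons_perm_range_iff, List.nil_append]
  refine and_congr_right fun hperm => ?_
  have hlt : ∀ x ∈ l, x < l.length := fun x hx => List.mem_range.1 (hperm.subset hx)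
  have hle : ∀ c ∈ l, c ≤ l.length := fun c hc => (hlt c hc).le
  have hlt' : ∀ x ∈ stackSort l, x < l.length := by simpa only [mem_stackSort] using hlt
  have hsort : stackSort (stackSort [l.length] ++ stackSort l)
      = stackSort (stackSort l) ++ [l.length] := by
    simpa [stackSort_nil, stackSort_singleton] using
      stackSort_append_cons (L := []) (by simp) hlt'
  rw [hsort, sortedLT_concat_iff (by simpa only [mem_stackSort] using hlt)]
  simp only [listAvoids132_of_length_le_one, SortedByTwoPasses, List.length_singleton, le_refl,
    List.forall_mem_singleton, true_and]
  exact and_congr_left fun _ => and_iff_left hle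

theorem exists_eq_of_mem_p132Words {w : List ℕ} (hw : w ∈ p132Words) (hne : w ≠ []) :
    (∃ l ∈ p132Words, w = appendMax l) ∨
      ∃ l ∈ p132Words, l ≠ [] ∧ (w = consMax l ∨ w = consMaxPair l) := by
  obtain ⟨n, hlen⟩ := Nat.exists_eq_succ_of_ne_zero (List.length_pos_iff.2 hne).ne'
  have hmem : n ∈ w := hw.1.mem_iff.2 (by simp [hlen])
  obtain ⟨L, R, rfl⟩ := List.append_of_mem hmem
  have hn : L.length + R.length = n := by simpa [← add_assoc] using hlen
  obtain ⟨hperm, ⟨-, -, hRL⟩, hsorted⟩ := (append_cons_mem_p132Words_iff hn).1 hw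
  rcases eq_or_ne R [] with rfl | hR
  · obtain rfl : L.length = n := hn
    exact Or.inl ⟨L, appendMax_mem_p132Words_iff.1 hw, rfl⟩
  right
  rcases eq_or_ne L [] with rfl | hL
  · obtain rfl : R.length = n := by simpa using hn
    exact ⟨R, consMax_mem_p132Words_iff.1 hw, hR, Or.inl rfl⟩
  obtain ⟨M, rfl⟩ := eq_singleton_of_sortedLT_stackSort_append hL hR hRL hsorted
  obtain rfl : R.length + 1 = n := by simpa [add_comm] using hn
  have hMle : M ≤ R.length := Nat.lt_succ_iff.1 (List.mem_range.1 (hperm.subset (by simp)))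
  have hleM : R.length ≤ M := by
    rcases List.mem_cons.1 (hperm.mem_iff.2 List.self_mem_range_succ) with h | h
    · exact h.le
    · exact hRL M (by simp) _ h
  obtain rfl := hMle.antisymm hleM
  exact ⟨R, consMaxPair_mem_p132Words_iff.1 hw, hR, Or.inr rfl⟩

theorem p132Words_sdiff_nil :
    p132Words \ {[]} = appendMax '' p132Words ∪
      (consMax '' (p132Words \ {[]}) ∪ consMaxPair '' (p132Words \ {[]})) := by
  ext w
  constructor
  · rintro ⟨hw, hne⟩
    rcases exists_eq_of_mem_p132Words hw hne with ⟨l, hl, rfl⟩ | ⟨l, hl, hlne, rfl | rfl⟩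
    · exact Or.inl ⟨l, hl, rfl⟩
    · exact Or.inr (Or.inl ⟨l, ⟨hl, hlne⟩, rfl⟩)
    · exact Or.inr (Or.inr ⟨l, ⟨hl, hlne⟩, rfl⟩)
  · rintro (⟨l, hl, rfl⟩ | ⟨l, ⟨hl, -⟩, rfl⟩ | ⟨l, ⟨hl, -⟩, rfl⟩)
    · exact ⟨appendMax_mem_p132Words_iff.2 hl, by simp [appendMax]⟩
    · exact ⟨consMax_mem_p132Words_iff.2 hl, by simp [consMax]⟩
    · exact ⟨consMaxPair_mem_p132Words_iff.2 hl, by simp [consMaxPair]⟩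

theorem disjoint_image_consMax_image_consMaxPair :
    Disjoint (consMax '' (p132Words \ {[]})) (consMaxPair '' (p132Words \ {[]})) := by
  rw [Set.disjoint_left]
  rintro _ ⟨l, -, rfl⟩ ⟨l', -, h⟩
  obtain ⟨hlen, rfl⟩ := List.cons.inj h
  simp at hlen

theorem appendMax_ne_append {l l' t : List ℕ} (hl' : l' ∈ p132Words) (hne : l' ≠ [])
    (ht : t ≠ []) : appendMax l ≠ t ++ l' := by
  intro h
  obtain ⟨l'', x, rfl⟩ := (List.eq_nil_or_concat' l').resolve_left hne
  have hlen : l.length + 1 = t.length + (l'' ++ [x]).length := by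
    simpa only [appendMax, List.length_append, List.length_singleton] using congrArg List.length h
  rw [appendMax, ← List.append_assoc] at h
  obtain rfl : l.length = x := by simpa using (List.append_inj' h rfl).2
  have hlt := lt_length_of_mem_p132Words hl' List.mem_concat_self
  have htpos := List.length_pos_iff.2 ht
  omega

theorem disjoint_image_appendMax :
    Disjoint (appendMax '' p132Words)
      (consMax '' (p132Words \ {[]}) ∪ consMaxPair '' (p132Words \ {[]})) := by
  rw [Set.disjoint_left]
  rintro _ ⟨l, -, rfl⟩ (⟨l', ⟨hl', hne⟩, h⟩ | ⟨l', ⟨hl', hne⟩, h⟩)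
  · exact appendMax_ne_append hl' hne (t := [_]) (by simp) h.symm
  · exact appendMax_ne_append hl' hne (t := [_, _]) (by simp) h.symm

theorem finite_p132Words_incExponent_eq (n : ℕ) : {w ∈ p132Words | incExponent w 1 = n}.Finite := by
  refine (List.finite_toSet (List.range n).permutations).subset fun w ⟨hw, hn⟩ => ?_
  rw [incExponent_apply_one (hw.1.nodup_iff.2 List.nodup_range)] at hn
  exact List.mem_permutations.2 (hn ▸ hw.1)

end Words

section GeneratingFunctions

theorem hasSum_image_iff {α β M : Type*} [AddCommMonoid M] [TopologicalSpace M] {f : β → M}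
    {g : α → β} {s : Set α} {a : M} (hg : Function.Injective g) :
    HasSum (fun i : g '' s => f i) a ↔ HasSum (fun i : s => f (g i)) a :=
  ((Equiv.Set.image g s hg).hasSum_iff (f := fun i : g '' s => f i)).symm

/-- The monomial `∏ x_d ^ (12…d)(w)` after `k` substitutions `x_d ↦ x_d x_{d+1}`. -/
noncomputable def weight (k : ℕ) (w : List ℕ) : MvPowerSeries ℕ+ ℤ :=
  MvPowerSeries.monomial ((pascalShift ^ k) (incExponent w)) 1

theorem weight_nil (k : ℕ) : weight k [] = 1 := by
  rw [weight, incExponent_nil, map_zero, MvPowerSeries.monomial_zero_one]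

theorem weight_appendMax (k : ℕ) {w : List ℕ} (hw : w ∈ p132Words) :
    weight k (appendMax w)
      = MvPowerSeries.monomial (predChooseExponent k) 1 * weight (k + 1) w := by
  rw [weight, appendMax, incExponent_concat fun x => lt_length_of_mem_p132Words hw, map_add, weight,
    MvPowerSeries.monomial_mul_monomial, one_mul, pow_succ]
  rfl

theorem weight_consMax (k : ℕ) {w : List ℕ} (hw : w ∈ p132Words) :
    weight k (consMax w) = MvPowerSeries.monomial (predChooseExponent k) 1 * weight k w := by
  have hlt : ∀ a ∈ [w.length], ∀ c ∈ w, c < a := by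
    simpa using fun x => lt_length_of_mem_p132Words hw
  rw [weight, consMax, ← List.singleton_append, incExponent_append hlt, incExponent_singleton,
    map_add, weight, MvPowerSeries.monomial_mul_monomial, one_mul, predChooseExponent]

theorem weight_consMaxPair (k : ℕ) {w : List ℕ} (hw : w ∈ p132Words) :
    weight k (consMaxPair w)
      = MvPowerSeries.monomial (predChooseExponent k + predChooseExponent (k + 1)) 1
        * weight k w := by
  have hlt : ∀ a ∈ [w.length] ++ [w.length + 1], ∀ c ∈ w, c < a := by
    have h := fun x => lt_length_of_mem_p132Words hw (x := x)
    simpa using ⟨h, fun x hx => (h x hx).le⟩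
  have hsplit : consMaxPair w = ([w.length] ++ [w.length + 1]) ++ w := rfl
  rw [weight, hsplit, incExponent_append hlt, incExponent_concat (by simp), incExponent_singleton,
    map_add, map_add, weight, MvPowerSeries.monomial_mul_monomial, one_mul, predChooseExponent,
    predChooseExponent, pow_succ]
  rfl

/-- The generating function `F_k` of the nonempty words, after `k` substitutions
`x_d ↦ x_d x_{d+1}`. -/
noncomputable def genFun (k : ℕ) : MvPowerSeries ℕ+ ℤ :=
  ∑' w : ↥(p132Words \ {[]}), weight k w

theorem hasSum_genFun (k : ℕ) :
    HasSum (fun w : ↥(p132Words \ {[]}) => weight k w) (genFun k) := by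
  refine (summable_monomial fun a => ?_).hasSum
  refine ((finite_p132Words_incExponent_eq (a 1)).preimage Subtype.val_injective.injOn).subset ?_
  rintro ⟨w, hw, -⟩ rfl
  exact ⟨hw, (pascalShift_pow_apply_one k _).symm⟩

theorem hasSum_weight_p132Words (k : ℕ) :
    HasSum (fun w : p132Words => weight k w) (1 + genFun k) := by
  have hnil : HasSum (fun w : ({[]} : Set (List ℕ)) => weight k w) 1 := by
    simpa [weight_nil] using hasSum_unique fun w : ({[]} : Set (List ℕ)) => weight k w
  have hunion : {[]} ∪ p132Words \ {[]} = p132Words :=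
    Set.union_sdiff_cancel (Set.singleton_subset_iff.2 nil_mem_p132Words)
  have h := hnil.add_disjoint (f := weight k) Set.disjoint_sdiff_right (hasSum_genFun k)
  rwa [hunion] at h

theorem genFun_eq (k : ℕ) :
    genFun k = MvPowerSeries.monomial (predChooseExponent k) 1 * (1 + genFun (k + 1))
      + (MvPowerSeries.monomial (predChooseExponent k) 1 * genFun k
      + MvPowerSeries.monomial (predChooseExponent k + predChooseExponent (k + 1)) 1
        * genFun k) := by
  have happend : HasSum (fun w : appendMax '' p132Words => weight k w)
      (MvPowerSeries.monomial (predChooseExponent k) 1 * (1 + genFun (k + 1))) :=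
    (hasSum_image_iff appendMax_injective).2 <|
      ((hasSum_weight_p132Words (k + 1)).mul_left _).congr_fun fun w => weight_appendMax k w.2
  have hcons : HasSum (fun w : consMax '' (p132Words \ {[]}) => weight k w)
      (MvPowerSeries.monomial (predChooseExponent k) 1 * genFun k) :=
    (hasSum_image_iff consMax_injective).2 <|
      ((hasSum_genFun k).mul_left _).congr_fun fun w => weight_consMax k w.2.1
  have hpair : HasSum (fun w : consMaxPair '' (p132Words \ {[]}) => weight k w)
      (MvPowerSeries.monomial (predChooseExponent k + predChooseExponent (k + 1)) 1
        * genFun k) :=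
    (hasSum_image_iff consMaxPair_injective).2 <|
      ((hasSum_genFun k).mul_left _).congr_fun fun w => weight_consMaxPair k w.2.1
  have hunion := happend.add_disjoint (f := weight k) disjoint_image_appendMax
    (hcons.add_disjoint (f := weight k) disjoint_image_consMax_image_consMaxPair hpair)
  rw [← p132Words_sdiff_nil] at hunion
  exact (hasSum_genFun k).unique hunion

theorem denomFactor_mul_genFun (k : ℕ) :
    denomFactor (k + 1) * genFun k
      = MvPowerSeries.monomial (predChooseExponent k) 1 * (1 + genFun (k + 1)) := by
  rw [denomFactor_succ]
  linear_combination genFun_eq k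

/-- The `n`-th summand `(∏ x_j ^ C(n, j)) / denom n` on the right-hand side. -/
noncomputable def summand (n : ℕ) : MvPowerSeries ℕ+ ℤ :=
  MvPowerSeries.monomial (chooseExponent n) 1 * denomInv n

theorem summand_mul_genFun (n : ℕ) :
    summand n * genFun n = summand (n + 1) * (1 + genFun (n + 1)) := by
  have hmonomial : (MvPowerSeries.monomial (chooseExponent (n + 1)) 1 : MvPowerSeries ℕ+ ℤ)
      = MvPowerSeries.monomial (chooseExponent n) 1
        * MvPowerSeries.monomial (predChooseExponent n) 1 := by
    rw [MvPowerSeries.monomial_mul_monomial, one_mul, chooseExponent_succ]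
  rw [summand, summand, denomInv_eq_denomInv_succ_mul, hmonomial]
  linear_combination (MvPowerSeries.monomial (chooseExponent n) 1 * denomInv (n + 1)) *
    denomFactor_mul_genFun n

theorem genFun_zero_eq (n : ℕ) :
    genFun 0 = ∑ i ∈ Finset.range n, summand (i + 1) + summand n * genFun n := by
  induction n with
  | zero => simp [summand, denomInv_zero, chooseExponent]
  | succ n ih =>
    rw [ih, Finset.sum_range_succ, summand_mul_genFun]
    ring

theorem coeff_summand_mul_eq_zero {n : ℕ} {a : ℕ+ →₀ ℕ} (h : a 1 < n) (f : MvPowerSeries ℕ+ ℤ) :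
    MvPowerSeries.coeff a (summand n * f) = 0 := by
  classical
  rw [summand, mul_assoc, MvPowerSeries.coeff_monomial_mul, if_neg]
  intro hle
  have hone : n ≤ a 1 := by simpa [chooseExponent_apply] using hle 1
  exact hone.not_gt h

theorem hasSum_summand : HasSum (fun n : ℕ+ => summand n) (genFun 0) := by
  rw [← Equiv.pnatEquivNat.symm.hasSum_iff, MvPowerSeries.WithPiTopology.hasSum_iff_hasSum_coeff]
  intro a
  rw [genFun_zero_eq (a 1 + 1), map_add, coeff_summand_mul_eq_zero (Nat.lt_succ_self _), add_zero,
    map_sum]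
  refine hasSum_sum_of_ne_finset_zero fun n hn => ?_
  have hlt : a 1 < n + 1 := Nat.lt_succ_of_lt (not_le.1 fun h => hn (by simpa using h))
  simpa using coeff_summand_mul_eq_zero hlt 1

end GeneratingFunctions

section PermutationWords

theorem ofFn_sublist_ofFn_iff {α : Type*} {d n : ℕ} {t : Fin d → α} {w : Fin n → α} :
    List.ofFn t <+ List.ofFn w ↔ ∃ f : Fin d ↪o Fin n, t = w ∘ f := by
  simp only [List.sublist_iff_exists_fin_orderEmbedding_get_eq, List.get_ofFn]
  let e_t := Fin.castOrderIso (List.length_ofFn (f := t))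
  let e_w := Fin.castOrderIso (List.length_ofFn (f := w))
  constructor
  · rintro ⟨f, hf⟩
    exact ⟨(e_t.symm.toOrderEmbedding.trans f).trans e_w.toOrderEmbedding,
      funext fun i => hf (e_t.symm i)⟩
  · rintro ⟨f, rfl⟩
    exact ⟨(e_t.toOrderEmbedding.trans f).trans e_w.symm.toOrderEmbedding, fun _ => rfl⟩

/-- One-line notation with entries in `ℕ`, so that permutations of all lengths become words over
one alphabet. -/
def permWord {n : ℕ} (π : Equiv.Perm (Fin n)) : List ℕ := List.ofFn fun i => (π i : ℕ)

theorem length_permWord {n : ℕ} (π : Equiv.Perm (Fin n)) : (permWord π).length = n :=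
  List.length_ofFn

theorem permWord_eq_map {n : ℕ} (π : Equiv.Perm (Fin n)) :
    permWord π = (oneLine π).map Fin.val := List.map_ofFn.symm

theorem oneLine_perm {n : ℕ} (π : Equiv.Perm (Fin n)) : oneLine π ~ List.finRange n := by
  simpa [oneLine, List.ofFn_id] using π.ofFn_comp_perm id

theorem permWord_perm {n : ℕ} (π : Equiv.Perm (Fin n)) : permWord π ~ List.range n := by
  rw [permWord_eq_map, ← List.map_coe_finRange_eq_range]
  exact (oneLine_perm π).map _

theorem permWord_injective :
    Function.Injective fun π : Σ n : ℕ, Equiv.Perm (Fin n) => permWord π.2 := by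
  rintro ⟨n, π⟩ ⟨m, ρ⟩ h
  obtain rfl : n = m := by simpa only [length_permWord] using congrArg List.length h
  congr 1
  exact Equiv.ext fun i => Fin.ext (congrFun (List.ofFn_injective h) i)

theorem exists_permWord_eq {l : List ℕ} (h : l ~ List.range l.length) :
    ∃ π : Equiv.Perm (Fin l.length), permWord π = l := by
  have hlt (i : Fin l.length) : l.get i < l.length := List.mem_range.1 (h.subset (l.get_mem i))
  have hinj : Function.Injective fun i : Fin l.length => (⟨l.get i, hlt i⟩ : Fin l.length) :=
    fun i j hij =>
      List.nodup_iff_injective_get.1 (h.nodup_iff.2 List.nodup_range) (Fin.mk.inj hij)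
  exact ⟨Equiv.ofBijective _ (Finite.injective_iff_bijective.1 hinj), List.ofFn_get l⟩

theorem incSublists_permWord (d : ℕ) {n : ℕ} (π : Equiv.Perm (Fin n)) :
    incSublists d (permWord π) = (fun f : Fin d ↪o Fin n => List.ofFn fun i => (π (f i) : ℕ)) ''
      patternOccurrences (1 : Equiv.Perm (Fin d)) π := by
  ext t
  constructor
  · rintro ⟨hs, rfl, ht⟩
    rw [← List.ofFn_get t, permWord, ofFn_sublist_ofFn_iff] at hs
    obtain ⟨f, hf⟩ := hs
    refine ⟨f, fun i j => ?_, (congrArg List.ofFn hf).symm.trans (List.ofFn_get t)⟩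
    have hmono := ht.strictMono_get.lt_iff_lt (a := i) (b := j)
    rwa [hf] at hmono
  · rintro ⟨f, hf, rfl⟩
    exact ⟨ofFn_sublist_ofFn_iff.2 ⟨f, rfl⟩, List.length_ofFn,
      List.sortedLT_ofFn_iff.2 fun i j hij => (hf i j).2 hij⟩

theorem ncard_incSublists_permWord (d : ℕ) {n : ℕ} (π : Equiv.Perm (Fin n)) :
    (incSublists d (permWord π)).ncard = incCount d π := by
  rw [incSublists_permWord, incCount]
  refine Set.ncard_image_of_injective _ fun f g hfg => RelEmbedding.ext fun i => ?_
  exact π.injective (Fin.ext (congrFun (List.ofFn_injective hfg) i))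

theorem avoidsPattern_perm132_iff {n : ℕ} (π : Equiv.Perm (Fin n)) :
    AvoidsPattern perm132 π ↔ ListAvoids132 (permWord π) := by
  have hofFn (a b c : ℕ) : [a, b, c] = List.ofFn ![a, b, c] := by simp
  rw [AvoidsPattern, Set.eq_empty_iff_forall_notMem]
  constructor
  · intro h a b c hac hcb hs
    rw [hofFn, permWord, ofFn_sublist_ofFn_iff] at hs
    obtain ⟨f, hf⟩ := hs
    have hval (i : Fin 3) : (π (f i) : ℕ) = ![a, b, c] i := (congrFun hf i).symm
    refine h f fun i j => ?_
    rw [Fin.lt_def, hval, hval]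
    fin_cases i <;> fin_cases j <;> simp [perm132, Equiv.swap_apply_def] <;> omega
  · intro h f hf
    refine h (π (f 0)) (π (f 1)) (π (f 2)) ((hf 0 2).2 (by decide)) ((hf 2 1).2 (by decide)) ?_
    rw [hofFn, permWord, ofFn_sublist_ofFn_iff]
    exact ⟨f, funext fun i => by fin_cases i <;> rfl⟩

theorem isTwoStackSortable_iff {n : ℕ} (π : Equiv.Perm (Fin n)) :
    IsTwoStackSortable π ↔ SortedByTwoPasses (permWord π) := by
  rw [permWord_eq_map, sortedByTwoPasses_map_iff Fin.val_strictMono]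
  have hone : oneLine (1 : Equiv.Perm (Fin n)) = List.finRange n := rfl
  have hperm : stackSort (stackSort (oneLine π)) ~ List.finRange n :=
    ((stackSort_perm _).trans (stackSort_perm _)).trans (oneLine_perm π)
  rw [IsTwoStackSortable, SortedByTwoPasses, hone]
  constructor
  · intro h
    rw [h]
    exact List.sortedLT_finRange n
  · exact fun h => h.eq_of_mem_iff (List.sortedLT_finRange n) fun _ => hperm.mem_iff

theorem permWord_mem_p132Words_iff (π : Σ n : ℕ, Equiv.Perm (Fin n)) :
    permWord π.2 ∈ p132Words ↔ π ∈ P132 := by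
  have hperm : permWord π.2 ~ List.range (permWord π.2).length := by
    simpa only [length_permWord] using permWord_perm π.2
  rw [p132Words, Set.mem_ofPred_eq, ← avoidsPattern_perm132_iff, ← isTwoStackSortable_iff, P132,
    Set.mem_ofPred_eq, and_iff_right hperm, and_comm]

theorem image_permWord_P132 :
    (fun π : Σ n : ℕ, Equiv.Perm (Fin n) => permWord π.2) '' P132 = p132Words := by
  ext l
  constructor
  · rintro ⟨π, hπ, rfl⟩
    exact (permWord_mem_p132Words_iff π).2 hπ
  · intro hl
    obtain ⟨π, hπ⟩ := exists_permWord_eq hl.1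
    exact ⟨⟨_, π⟩, (permWord_mem_p132Words_iff ⟨_, π⟩).1 (hπ.symm ▸ hl), hπ⟩

theorem weight_zero_permWord {n : ℕ} (π : Equiv.Perm (Fin n)) :
    weight 0 (permWord π) = ∏ᶠ d : ℕ+, MvPowerSeries.X d ^ incCount d π := by
  simp only [← ncard_incSublists_permWord, ← incExponent_apply, finprod_X_pow]
  rfl

theorem hasSum_P132 :
    HasSum (fun π : P132 =>
        (∏ᶠ d : ℕ+, MvPowerSeries.X d ^ incCount d π.1.2 : MvPowerSeries ℕ+ ℤ))
      (1 + genFun 0) := by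
  have h := hasSum_weight_p132Words 0
  rw [← image_permWord_P132, hasSum_image_iff permWord_injective] at h
  exact h.congr_fun fun π => (weight_zero_permWord π.1.2).symm

end PermutationWords

/-- Infinite sums are sums of families of formal power series in `x_1, x_2, …` over `ℤ`, in the
topology of coefficientwise (eventually constant) convergence. -/
theorem mainTheorem7 :
    Summable (fun π : P132 =>
        (∏ᶠ d : ℕ+, MvPowerSeries.X d ^ incCount d π.1.2 : MvPowerSeries ℕ+ ℤ)) ∧
    Summable (fun n : ℕ+ =>
        (∏ᶠ j : ℕ+, MvPowerSeries.X j ^ (n : ℕ).choose j : MvPowerSeries ℕ+ ℤ) * denomInv n) ∧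
    ∑' π : P132, (∏ᶠ d : ℕ+, MvPowerSeries.X d ^ incCount d π.1.2 : MvPowerSeries ℕ+ ℤ)
      = 1 + ∑' n : ℕ+,
          (∏ᶠ j : ℕ+, MvPowerSeries.X j ^ (n : ℕ).choose j : MvPowerSeries ℕ+ ℤ) * denomInv n := by
  have hsummand (n : ℕ+) : (∏ᶠ j : ℕ+, MvPowerSeries.X j ^ (n : ℕ).choose j :
      MvPowerSeries ℕ+ ℤ) * denomInv n = summand n := by
    simp only [← chooseExponent_apply, finprod_X_pow, summand]
  simp only [hsummand]
  exact ⟨hasSum_P132.summable, hasSum_summand.summable,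
    by rw [hasSum_P132.tsum_eq, hasSum_summand.tsum_eq]⟩
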